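/- For $N\ge 1$ let $\mathfrak S_N$ be the symmetric group on $\{1,\dots,N\}$ and $\mathfrak A_N$ the alternating group. For a group $G$ generated by a set $T=T^{-1}$ let $\ell_T(g)$ be the least $k$ such that $g$ is a product of $k$ elements of $T$, and write $x\le_T y$ if $\ell_T(y)=\ell_T(x)+\ell_T(x^{-1}y)$. Let $\le_{\mathbf 2}$ denote this order on $\mathfrak S_N$ for $T$ the set of all transpositions, and $\le_{\mathbf 3}$ this order on $\mathfrak A_N$ for $T$ the set of all $3$-cycles. A permutation $x\in\mathfrak S_N$ is called a noncrossing partition if $x\le_{\mathbf 2}(1\;2\;\ldots\;N)$. An increasing cycle $(u_1\;u_2\;\ldots\;u_q)$, $u_1<u_2<\dots<u_q$, has Property (OD) if $q$ is odd and $u_{j+1}-u_j$ is odd for all $1\le j\le q-1$. Let $O\!N\!C_N$ be the set of all noncrossing partitions $x\in\mathfrak S_N$ such that every cycle of $x$ (fixed points counted as cycles of length $1$) is an increasing cycle with Property (OD). **Proposition.** Let $n\ge 0$. A permutation $x\in\mathfrak A_{2n+1}$ satisfies $x\le_{\mathbf 3}(1\;2\;\ldots\;2n{+}1)$ if and only if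 $x\in O\!N\!C_{2n+1}$. -/

import Mathlib

open Equiv

namespace AltPrefix

/-- The word length of `g` with respect to a subset `T` of a group: the least `k` for which
`g = t₁ t₂ ⋯ t_k` with all `tᵢ ∈ T`. -/
noncomputable def wordLength {G : Type*} [Group G] (T : Set G) (g : G) : ℕ :=
  sInf {k : ℕ | ∃ w : List G, w.length = k ∧ (∀ t ∈ w, t ∈ T) ∧ w.prod = g}

/-- The `T`-prefix order: `x ≤_T y` if and only if `ℓ_T(y) = ℓ_T(x) + ℓ_T(x⁻¹ y)`. -/
def PrefixLE {G : Type*} [Group G] (T : Set G) (x y : G) : Prop :=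
  wordLength T y = wordLength T x + wordLength T (x⁻¹ * y)

/-- If `T` generates the group and is closed under inverses, then every element is a word
over `T`, so that the infimum defining `wordLength` is attained. -/
theorem exists_word {G : Type*} [Group G] (T : Set G) (hT : Subgroup.closure T = ⊤)
    (hinv : ∀ t ∈ T, t⁻¹ ∈ T) (g : G) :
    ∃ w : List G, w.length = wordLength T g ∧ (∀ t ∈ w, t ∈ T) ∧ w.prod = g := by
  have hg : g ∈ (Subgroup.closure T).toSubmonoid := by rw [hT]; trivial
  rw [Subgroup.closure_toSubmonoid] at hg
  obtain ⟨l, hl, hprod⟩ := Submonoid.exists_list_of_mem_closure hg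
  have hne : {k : ℕ | ∃ w : List G, w.length = k ∧ (∀ t ∈ w, t ∈ T) ∧ w.prod = g}.Nonempty := by
    refine ⟨l.length, l, rfl, fun t ht => ?_, hprod⟩
    rcases hl t ht with h | h
    · exact h
    · simpa using hinv _ h
  exact Nat.sInf_mem hne

/-- The set of all transpositions of the symmetric group on `N` letters. The `N` letters
`1, …, N` are represented by `Fin N`, the letter `i` by `i - 1`. -/
def transpositions (N : ℕ) : Set (Perm (Fin N)) := {t | t.IsSwap}

/-- The set of all `3`-cycles, as a subset of the alternating group on `N` letters. -/
def threeCycles (N : ℕ) : Set (alternatingGroup (Fin N)) :=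
  {t | (t : Perm (Fin N)).IsThreeCycle}

theorem exists_transposition_word (N : ℕ) (x : Perm (Fin N)) :
    ∃ w : List (Perm (Fin N)), w.length = wordLength (transpositions N) x ∧
      (∀ t ∈ w, t ∈ transpositions N) ∧ w.prod = x := by
  refine exists_word _ (Perm.closure_isSwap) ?_ x
  rintro t ⟨i, j, hij, rfl⟩
  exact ⟨i, j, hij, by simp⟩

theorem exists_threeCycle_word (N : ℕ) (x : alternatingGroup (Fin N)) :
    ∃ w : List (alternatingGroup (Fin N)), w.length = wordLength (threeCycles N) x ∧
      (∀ t ∈ w, t ∈ threeCycles N) ∧ w.prod = x := by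
  refine exists_word _ alternatingGroup.closure_isThreeCycles_eq_top ?_ x
  intro t ht
  exact Perm.IsThreeCycle.inv ht

/-- The order `≤₂` on the symmetric group, generated by transpositions. -/
def LETwo {N : ℕ} (x y : Perm (Fin N)) : Prop := PrefixLE (transpositions N) x y

/-- The order `≤₃` on the alternating group, generated by `3`-cycles. -/
def LEThree {N : ℕ} (x y : alternatingGroup (Fin N)) : Prop := PrefixLE (threeCycles N) x y

/-- The long cycle `(1 2 … N)`. -/
def longCycle (N : ℕ) : Perm (Fin N) := finRotate N

/-- The long cycle `(1 2 … 2n+1)` as an element of the alternating group. -/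
def altLongCycle (n : ℕ) : alternatingGroup (Fin (2 * n + 1)) :=
  ⟨longCycle (2 * n + 1), Perm.finRotate_bit1_mem_alternatingGroup⟩

/-- The noncrossing partitions: permutations `x` with `x ≤₂ (1 2 … N)`. -/
def NC (N : ℕ) : Set (Perm (Fin N)) := {x | LETwo x (longCycle N)}

/-- The cycle of `x` through `i` (possibly a fixed point, written `(i)`) can be written as
the increasing cycle `(u₁ < u₂ < ⋯ < u_q)`. -/
def IsIncreasingCycleAt {N : ℕ} (x : Perm (Fin N)) (i : Fin N) (u : List (Fin N)) : Prop :=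
  i ∈ u ∧ u.Pairwise (· < ·) ∧ u.formPerm = x.cycleOf i

/-- Property (OD) of an increasing cycle `(u₁ < ⋯ < u_q)`: the length `q` is odd, and
`u_{j+1} - u_j` is odd for all `1 ≤ j ≤ q - 1`. -/
def PropertyOD {N : ℕ} (u : List (Fin N)) : Prop :=
  Odd u.length ∧ u.IsChain (fun a b => Odd (((b : ℕ) : ℤ) - ((a : ℕ) : ℤ)))

/-- The noncrossing partitions all of whose cycles (fixed points included) have
Property (OD). -/
def ONC (N : ℕ) : Set (Perm (Fin N)) :=
  {x | x ∈ NC N ∧ ∀ i : Fin N, ∃ u : List (Fin N), IsIncreasingCycleAt x i u ∧ PropertyOD u}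

end AltPrefix

/-!
Let `c` be the long cycle on `N = 2 * n + 1` points and `y = x⁻¹ c`. Both conditions on `x` are
shown to say that `x` and `y` have `N + 1` cycles in total (fixed points included), all of odd
length (`leThree_altLongCycle_iff`).

*Word lengths.* A letter imposes one linear condition on invariant functions if it is a
transposition, and two if it is a three-cycle. Hence `N ≤ #cycles x + ℓ₂ x` and
`N ≤ #cycles x + 2 ℓ₃ x`, and in case of equality in the latter the letters of a shortest word
preserve every cycle of `x`, so that `x` restricts to an even permutation of each of its cycles,
which are therefore odd (`oddCycles_of_card_le`). Conversely, a permutation with odd cycles only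
is a product of `(N - #cycles) / 2` three-cycles (`OddCycles.wordLength_le`).

*Weak descents.* Every cycle of `x` contains a weak descent, a point `j` with `x j ≤ j`, and `x`
and `y` have exactly `N + 1` weak descents together (`card_weakDescents_add`). So `x` and `y` have
at most `N + 1` cycles, and if they have `N + 1`, then each cycle has a single weak descent, that
is, it is an increasing cycle.

*Parity.* Let `defect x j` be `x j - j + [x j ≤ j] + 1` modulo two. An increasing cycle has Property
(OD) exactly if the defect vanishes along it. The sum of the defect over a cycle with one weak
descent is the length of the cycle plus one, and `defect y i = defect x (y i)`
(`defect_inv_mul_longCycle`). If the defect of `x` vanishes, then so does that of `y`, and all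
cycles of `x` and `y` are odd. Conversely, if all cycles are odd, then the defect of `x` sums to
zero over the cycles of `x` and over the cycles of `y`. Regard a point `j` as an edge joining the
cycle of `x` to the cycle of `y` through `j`. This bipartite graph is connected, because
`x y = c` is transitive, and has `N` edges and `N + 1` vertices, so it is a tree, and an edge
function on a tree whose sum at every vertex is zero vanishes
(`eq_zero_of_vertex_sums_eq_zero`).
-/

namespace AltPrefix

open Finset

/-! ### Cycles of a permutation -/

/-- The cycles of a permutation, fixed points included: the classes of the relation
"in the same cycle". -/
def Cycles {α : Type*} (x : Perm α) : Type _ := Quotient (Perm.SameCycle.setoid x)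

/-- The cycle through a point. -/
def cycleThrough {α : Type*} (x : Perm α) (a : α) : Cycles x := Quotient.mk _ a

noncomputable instance {α : Type*} (x : Perm α) : DecidableEq (Cycles x) := Classical.decEq _

noncomputable instance {α : Type*} [Finite α] (x : Perm α) : Fintype (Cycles x) :=
  letI : Finite (Cycles x) := inferInstanceAs (Finite (Quotient _))
  Fintype.ofFinite _

section Cycles

variable {α : Type*} {x : Perm α}

theorem cycleThrough_eq_iff {a b : α} :
    cycleThrough x a = cycleThrough x b ↔ x.SameCycle a b := Quotient.eq

theorem cycleThrough_surjective (x : Perm α) : Function.Surjective (cycleThrough x) :=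
  Quotient.mk_surjective

@[simp]
theorem cycleThrough_apply (a : α) : cycleThrough x (x a) = cycleThrough x a :=
  cycleThrough_eq_iff.2 (Perm.sameCycle_apply_left.2 (Perm.SameCycle.refl x a))

/-- A function invariant under `x` factors through the cycles of `x`. -/
theorem eq_of_cycleThrough_eq {β : Type*} {f : α → β} (hf : ∀ a, f (x a) = f a) {a b : α}
    (h : cycleThrough x a = cycleThrough x b) : f a = f b := by
  obtain ⟨k, rfl⟩ := cycleThrough_eq_iff.1 h
  have hp : ∀ (k : ℤ) (a : α), f ((x ^ k) a) = f a := by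
    intro k
    induction k with
    | zero => simp
    | succ k ih => intro a; rw [zpow_add_one, Perm.mul_apply, ih, hf]
    | pred k ih =>
      intro a
      rw [zpow_sub_one, Perm.mul_apply, ih, ← hf (x⁻¹ a), ← Perm.mul_apply, mul_inv_cancel,
        Perm.one_apply]
  exact (hp k a).symm

/-- Every cycle, fixed points included, has odd length. -/
def OddCycles [Fintype α] (x : Perm α) : Prop := ∀ q : Cycles x, Odd #{a | cycleThrough x a = q}

theorem sum_cycle_apply [Fintype α] {M : Type*} [AddCommMonoid M] (f : α → M) (q : Cycles x) :
    ∑ a with cycleThrough x a = q, f (x a) = ∑ a with cycleThrough x a = q, f a := by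
  refine sum_equiv x (fun a => ?_) (fun _ _ => rfl)
  simp

theorem card_support_cycleOf [Fintype α] [DecidableEq α] {a : α} (ha : x a ≠ a) :
    #(x.cycleOf a).support = #{b | cycleThrough x b = cycleThrough x a} := by
  congr 1
  ext b
  rw [Perm.mem_support_cycleOf_iff' ha, mem_filter_univ, cycleThrough_eq_iff]
  exact Perm.sameCycle_comm

theorem card_cycle_of_fixed [Fintype α] {a : α} (ha : x a = a) :
    #{b | cycleThrough x b = cycleThrough x a} = 1 := by
  rw [card_eq_one]
  refine ⟨a, ?_⟩
  ext b
  rw [mem_filter_univ, mem_singleton, cycleThrough_eq_iff]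
  refine ⟨fun h => (h.symm.eq_of_left ha).symm, ?_⟩
  rintro rfl
  exact Perm.SameCycle.refl _ _

/-- The number of cycles in terms of the cycle type, which omits the fixed points. -/
theorem card_cycles_add_card_support_le [Fintype α] [DecidableEq α] (x : Perm α) :
    Fintype.card (Cycles x) + #x.support ≤ x.cycleType.card + Fintype.card α := by
  have hc : ∀ c ∈ x.cycleFactorsFinset, ∃ a, c a ≠ a := by
    intro c hc
    obtain ⟨a, ha, -⟩ := (Perm.mem_cycleFactorsFinset_iff.1 hc).1
    exact ⟨a, ha⟩
  choose g hg using hc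
  have hsurj : Function.Surjective
      (Sum.elim (fun a : {a // a ∈ x.supportᶜ} => cycleThrough x a.1)
        (fun c : {c // c ∈ x.cycleFactorsFinset} => cycleThrough x (g c.1 c.2))) := by
    intro q
    obtain ⟨a, rfl⟩ := cycleThrough_surjective x q
    by_cases ha : a ∈ x.support
    · have hm := Perm.cycleOf_mem_cycleFactorsFinset_iff.2 ha
      refine ⟨Sum.inr ⟨_, hm⟩, cycleThrough_eq_iff.2 ?_⟩
      have := Perm.mem_support.2 (hg _ hm)
      exact (Perm.mem_support_cycleOf_iff.1 this).1.symm
    · exact ⟨Sum.inl ⟨a, by simpa using ha⟩, rfl⟩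
  have h1 := Fintype.card_le_of_surjective _ hsurj
  rw [Fintype.card_sum, Fintype.card_coe, Fintype.card_coe, card_compl] at h1
  have h2 : x.cycleType.card = #x.cycleFactorsFinset := by
    rw [Perm.cycleType_def, Multiset.card_map]; rfl
  have h3 := card_le_univ x.support
  omega

theorem OddCycles.odd_of_mem_cycleType [Fintype α] [DecidableEq α] (hx : OddCycles x) {k : ℕ}
    (hk : k ∈ x.cycleType) : Odd k := by
  rw [Perm.cycleType_def, Multiset.mem_map] at hk
  obtain ⟨c, hc, rfl⟩ := hk
  have hc' : c ∈ x.cycleFactorsFinset := hc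
  obtain ⟨a, ha, -⟩ := (Perm.mem_cycleFactorsFinset_iff.1 hc').1
  have hcx := Perm.cycle_is_cycleOf (Perm.mem_support.2 ha) hc'
  have hxa : x a ≠ a := by
    rw [hcx, Perm.cycleOf_apply_self] at ha
    exact ha
  rw [Function.comp_apply, hcx, card_support_cycleOf hxa]
  exact hx _

theorem odd_card_cycle_of_sign [Fintype α] [DecidableEq α] {a : α}
    (h : Perm.sign (x.cycleOf a) = 1) :
    Odd #{b | cycleThrough x b = cycleThrough x a} := by
  by_cases ha : x a = a
  · rw [card_cycle_of_fixed ha]; exact odd_one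
  · rw [(x.isCycle_cycleOf ha).sign, card_support_cycleOf ha] at h
    by_contra ho
    rw [Nat.not_odd_iff_even] at ho
    rw [ho.neg_one_pow] at h
    exact absurd h (by decide)

end Cycles

/-! ### Permutations with odd cycles as products of three-cycles -/

section Words

variable {α : Type*} [DecidableEq α]

theorem isThreeCycle_swap_mul_swap [Fintype α] {a b c : α} (hab : a ≠ b) (hac : a ≠ c)
    (hbc : b ≠ c) : (swap a b * swap b c).IsThreeCycle := by
  rw [swap_comm a b]
  exact Perm.isThreeCycle_swap_mul_swap_same hab.symm hbc hac

/-- A cycle of length `2k + 1` is a product of `k` three-cycles. -/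
theorem exists_threeCycle_list_formPerm [Fintype α] (k : ℕ) :
    ∀ l : List α, l.Nodup → l.length = 2 * k + 1 →
      ∃ w : List (Perm α), (∀ t ∈ w, t.IsThreeCycle) ∧ w.prod = l.formPerm ∧ w.length = k := by
  induction k with
  | zero =>
    intro l _ hl
    obtain ⟨a, rfl⟩ := List.length_eq_one_iff.1 (by simpa using hl)
    exact ⟨[], by simp, by simp, rfl⟩
  | succ k ih =>
    intro l hn hl
    match l, hn, hl with
    | a :: b :: c :: l, hn, hl =>
      obtain ⟨w, hw, hp, hk⟩ := ih (c :: l) (by simp_all) (by simp at hl ⊢; omega)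
      refine ⟨swap a b * swap b c :: w, ?_, ?_, by simp [hk]⟩
      · simp only [List.nodup_cons, List.mem_cons, not_or] at hn
        intro t ht
        rcases List.mem_cons.1 ht with rfl | ht
        · exact isThreeCycle_swap_mul_swap hn.1.1 hn.1.2.1 hn.2.1.1
        · exact hw t ht
      · rw [List.prod_cons, hp, List.formPerm_cons_cons, List.formPerm_cons_cons, mul_assoc]

theorem exists_threeCycle_list_of_odd_cycleType [Fintype α] (x : Perm α)
    (hx : ∀ k ∈ x.cycleType, Odd k) :
    ∃ w : List (Perm α), (∀ t ∈ w, t.IsThreeCycle) ∧ w.prod = x ∧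
      2 * w.length + x.cycleType.card = #x.support := by
  induction x using Perm.cycle_induction_on with
  | base_one => exact ⟨[], by simp, by simp, by simp⟩
  | base_cycles σ hσ =>
    obtain ⟨a, ha, -⟩ := id hσ
    have hlen : (σ.toList a).length = #σ.support := by
      rw [Perm.length_toList, hσ.cycleOf_eq ha]
    obtain ⟨k, hk⟩ := hx #σ.support (by rw [hσ.cycleType]; exact Multiset.mem_singleton_self _)
    obtain ⟨w, hw, hp, hl⟩ := exists_threeCycle_list_formPerm k (σ.toList a)
      (Perm.nodup_toList σ a) (hlen.trans hk)
    refine ⟨w, hw, by rw [hp, Perm.formPerm_toList, hσ.cycleOf_eq ha], ?_⟩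
    rw [hσ.cycleType, hl, hk]
    rfl
  | induction_disjoint σ τ hd _ ihσ ihτ =>
    rw [hd.cycleType_mul] at hx ⊢
    obtain ⟨w, hw, hp, hl⟩ := ihσ fun k hk => hx k (Multiset.mem_add.2 (Or.inl hk))
    obtain ⟨v, hv, hq, hm⟩ := ihτ fun k hk => hx k (Multiset.mem_add.2 (Or.inr hk))
    refine ⟨w ++ v, ?_, by rw [List.prod_append, hp, hq], ?_⟩
    · intro t ht
      rcases List.mem_append.1 ht with h | h
      exacts [hw t h, hv t h]
    · rw [hd.card_support_mul, ← hl, ← hm, List.length_append, Multiset.card_add]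
      ring

theorem OddCycles.exists_threeCycle_list [Fintype α] {x : Perm α} (hx : OddCycles x) :
    ∃ w : List (Perm α), (∀ t ∈ w, t.IsThreeCycle) ∧ w.prod = x ∧
      2 * w.length + Fintype.card (Cycles x) ≤ Fintype.card α := by
  obtain ⟨w, hw, hp, hl⟩ := exists_threeCycle_list_of_odd_cycleType x
    fun k hk => hx.odd_of_mem_cycleType hk
  refine ⟨w, hw, hp, ?_⟩
  have := card_cycles_add_card_support_le x
  omega

end Words

/-! ### Functions fixed by a word of permutations -/

section Fixed

variable {α : Type*}

/-- The space of rational functions on `α` that are invariant under all letters of the word `w`. -/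
def fixedFunctions (w : List (Perm α)) : Submodule ℚ (α → ℚ) where
  carrier := {f | ∀ t ∈ w, ∀ a, f (t a) = f a}
  add_mem' hf hg t ht a := by simp [hf t ht a, hg t ht a]
  zero_mem' _ _ _ := rfl
  smul_mem' r f hf t ht a := by simp [hf t ht a]

theorem mem_fixedFunctions {w : List (Perm α)} {f : α → ℚ} :
    f ∈ fixedFunctions w ↔ ∀ t ∈ w, ∀ a, f (t a) = f a := Iff.rfl

theorem fixedFunctions_cons (t : Perm α) (w : List (Perm α)) :
    fixedFunctions (t :: w) = fixedFunctions [t] ⊓ fixedFunctions w := by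
  ext f
  simp [mem_fixedFunctions]

theorem fixedFunctions_le_prod (w : List (Perm α)) :
    fixedFunctions w ≤ fixedFunctions [w.prod] := by
  induction w with
  | nil => intro f _; simp [mem_fixedFunctions]
  | cons t w ih =>
    rw [fixedFunctions_cons]
    rintro f ⟨h1, h2⟩
    have h3 := ih h2
    rw [SetLike.mem_coe] at h1
    simp only [mem_fixedFunctions, List.mem_singleton, forall_eq, List.prod_cons,
      Perm.mul_apply] at h1 h3 ⊢
    intro a
    rw [h1, h3]

variable [Fintype α]

/-- Each letter imposes a bounded number of linear conditions, so the codimension of the fixed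
space grows at most linearly with the length of the word. -/
theorem card_le_finrank_fixedFunctions (m : ℕ) (w : List (Perm α))
    (hw : ∀ t ∈ w, Fintype.card α ≤ Module.finrank ℚ (fixedFunctions [t]) + m) :
    Fintype.card α ≤ Module.finrank ℚ (fixedFunctions w) + m * w.length := by
  induction w with
  | nil =>
    have : fixedFunctions ([] : List (Perm α)) = ⊤ := by
      ext f; simp [mem_fixedFunctions]
    rw [this]
    simp
  | cons t w ih =>
    have h1 := ih fun s hs => hw s (List.mem_cons_of_mem _ hs)
    have h2 := hw t List.mem_cons_self
    have h3 := Submodule.finrank_sup_add_finrank_inf_eq (fixedFunctions [t]) (fixedFunctions w)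
    have h4 := Submodule.finrank_le (fixedFunctions [t] ⊔ fixedFunctions w)
    rw [Module.finrank_fintype_fun_eq_card] at h4
    rw [fixedFunctions_cons, List.length_cons, mul_add]
    omega

theorem finrank_fixedFunctions_le_card_cycles (x : Perm α) :
    Module.finrank ℚ (fixedFunctions [x]) ≤ Fintype.card (Cycles x) := by
  rw [← Module.finrank_fintype_fun_eq_card ℚ]
  choose s hs using cycleThrough_surjective x
  refine LinearMap.finrank_le_finrank_of_injective
    (f := (LinearMap.funLeft ℚ ℚ s).comp (fixedFunctions [x]).subtype) ?_
  rintro ⟨f, hf⟩ ⟨g, hg⟩ h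
  simp only [mem_fixedFunctions, List.mem_singleton, forall_eq] at hf hg
  ext a
  change f a = g a
  have h1 := congrFun h (cycleThrough x a)
  simp only [LinearMap.comp_apply, Submodule.subtype_apply, LinearMap.funLeft_apply] at h1
  rw [← eq_of_cycleThrough_eq hf (hs (cycleThrough x a)), h1,
    eq_of_cycleThrough_eq hg (hs (cycleThrough x a))]

theorem card_le_finrank_fixedFunctions_swap [DecidableEq α] {t : Perm α} (ht : t.IsSwap) :
    Fintype.card α ≤ Module.finrank ℚ (fixedFunctions [t]) + 1 := by
  obtain ⟨a, b, -, rfl⟩ := ht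
  let p (c : α) : (α → ℚ) →ₗ[ℚ] ℚ := LinearMap.proj c
  let φ : (α → ℚ) →ₗ[ℚ] ℚ := p a - p b
  have hle : LinearMap.ker φ ≤ fixedFunctions [swap a b] := by
    intro f hf
    have hf' : f a = f b := sub_eq_zero.1 (LinearMap.mem_ker.1 hf)
    simp only [mem_fixedFunctions, List.mem_singleton, forall_eq]
    intro c
    rw [swap_apply_def]
    split_ifs with h1 h2
    · rw [h1, hf']
    · rw [h2, hf']
    · rfl
  have h1 := Submodule.finrank_mono hle
  have h2 := LinearMap.finrank_range_add_finrank_ker φ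
  have h3 := Submodule.finrank_le (LinearMap.range φ)
  rw [Module.finrank_fintype_fun_eq_card] at h2
  rw [Module.finrank_self] at h3
  omega

theorem exists_swaps_of_isThreeCycle [DecidableEq α] {t : Perm α} (ht : t.IsThreeCycle) :
    ∃ s r : Perm α, s.IsSwap ∧ r.IsSwap ∧ t = s * r := by
  obtain ⟨a, ha⟩ := card_pos.1 (ht.card_support ▸ Nat.succ_pos 2 : 0 < #t.support)
  have hn := ht.nodup_iff_mem_support.2 ha
  simp only [List.nodup_cons, List.mem_cons, not_or] at hn
  exact ⟨_, _, ⟨a, t a, hn.1.1, rfl⟩, ⟨t a, t (t a), hn.2.1.1, rfl⟩,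
    ht.eq_swap_mul_swap_iff_mem_support.2 ha⟩

theorem card_le_finrank_fixedFunctions_threeCycle [DecidableEq α] {t : Perm α}
    (ht : t.IsThreeCycle) :
    Fintype.card α ≤ Module.finrank ℚ (fixedFunctions [t]) + 2 := by
  obtain ⟨s, r, hs, hr, rfl⟩ := exists_swaps_of_isThreeCycle ht
  have h1 := card_le_finrank_fixedFunctions 1 [s, r] (by
    intro t ht
    rcases List.mem_pair.1 ht with rfl | rfl
    exacts [card_le_finrank_fixedFunctions_swap hs, card_le_finrank_fixedFunctions_swap hr])
  have h2 := Submodule.finrank_mono (fixedFunctions_le_prod [s, r])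
  rw [List.prod_cons, List.prod_singleton] at h2
  simp only [List.length_cons, List.length_nil] at h1
  omega

theorem card_le_card_cycles_of_swaps [DecidableEq α] {w : List (Perm α)}
    (hw : ∀ t ∈ w, t.IsSwap) :
    Fintype.card α ≤ Fintype.card (Cycles w.prod) + w.length := by
  have h1 := card_le_finrank_fixedFunctions 1 w fun t ht =>
    card_le_finrank_fixedFunctions_swap (hw t ht)
  have h2 := Submodule.finrank_mono (fixedFunctions_le_prod w)
  have h3 := finrank_fixedFunctions_le_card_cycles w.prod
  omega

theorem sign_ofSubtype_prod_eq_one [DecidableEq α] (p : α → Prop) [DecidablePred p]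
    (w : List (Perm α)) (h3 : ∀ t ∈ w, t ^ 3 = 1) (hp : ∀ t ∈ w, ∀ a, p (t a) ↔ p a) :
    ∃ h : ∀ a, p (w.prod a) ↔ p a, Perm.sign (w.prod.subtypePerm h) = 1 := by
  induction w with
  | nil => exact ⟨fun _ => Iff.rfl, Perm.sign_one⟩
  | cons t w ih =>
    obtain ⟨h, hs⟩ := ih (fun s hs => h3 s (List.mem_cons_of_mem _ hs))
      (fun s hs => hp s (List.mem_cons_of_mem _ hs))
    have ht := hp t List.mem_cons_self
    have h1 : Perm.sign (t.subtypePerm ht) = 1 := by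
      have : Perm.sign (t.subtypePerm ht) ^ 3 = 1 := by
        rw [← map_pow, Perm.subtypePerm_pow, ← Perm.sign_one (α := {a // p a})]
        congr 1
        ext a
        simp [h3 t List.mem_cons_self]
      rcases Int.units_eq_one_or (Perm.sign (t.subtypePerm ht)) with h | h
      · exact h
      · rw [h] at this
        exact absurd this (by decide)
    refine ⟨fun a => by rw [List.prod_cons, Perm.mul_apply, ht, h], ?_⟩
    have h2 : (t :: w).prod.subtypePerm (p := p) (fun a => by
        rw [List.prod_cons, Perm.mul_apply, ht, h])
        = t.subtypePerm ht * w.prod.subtypePerm h := by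
      rw [Perm.subtypePerm_mul]
      simp only [List.prod_cons]
    rw [h2, map_mul, h1, hs, one_mul]

/-- If a word of three-cycles is as short as the number of cycles of its product allows, then
every letter preserves every cycle of the product. -/
theorem cycleThrough_letter_eq [DecidableEq α] {w : List (Perm α)}
    (hw : ∀ t ∈ w, t.IsThreeCycle)
    (hcard : Fintype.card (Cycles w.prod) + 2 * w.length ≤ Fintype.card α)
    {t : Perm α} (ht : t ∈ w) (a : α) :
    cycleThrough w.prod (t a) = cycleThrough w.prod a := by
  have h1 := card_le_finrank_fixedFunctions 2 w fun t ht =>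
    card_le_finrank_fixedFunctions_threeCycle (hw t ht)
  have h3 := finrank_fixedFunctions_le_card_cycles w.prod
  have heq := Submodule.eq_of_le_of_finrank_le (fixedFunctions_le_prod w) (by omega)
  -- the indicator function of a cycle of the product is fixed by the product
  have hmem : (fun b => if cycleThrough w.prod b = cycleThrough w.prod a then (1 : ℚ) else 0) ∈
      fixedFunctions w := by
    rw [heq]
    simp [mem_fixedFunctions]
  have h4 := hmem t ht a
  by_contra hne
  simp [hne] at h4

theorem oddCycles_of_card_le [DecidableEq α] {w : List (Perm α)}
    (hw : ∀ t ∈ w, t.IsThreeCycle)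
    (hcard : Fintype.card (Cycles w.prod) + 2 * w.length ≤ Fintype.card α) :
    OddCycles w.prod := by
  intro q
  obtain ⟨a, rfl⟩ := cycleThrough_surjective _ q
  refine odd_card_cycle_of_sign ?_
  obtain ⟨h, hs⟩ := sign_ofSubtype_prod_eq_one (fun b => w.prod.SameCycle a b) w
    (fun t ht => by rw [← (hw t ht).orderOf, pow_orderOf_eq_one]) (fun t ht b => by
      rw [← cycleThrough_eq_iff, ← cycleThrough_eq_iff, cycleThrough_letter_eq hw hcard ht])
  rw [Perm.cycleOf, Perm.sign_ofSubtype]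
  exact hs

end Fixed

/-! ### Word lengths -/

section WordLength

variable {G : Type*} [Group G] {T : Set G}

theorem wordLength_le {w : List G} (hw : ∀ t ∈ w, t ∈ T) :
    wordLength T w.prod ≤ w.length := Nat.sInf_le ⟨w, rfl, hw, rfl⟩

theorem wordLength_mul_le (hT : ∀ g, ∃ w : List G, w.length = wordLength T g ∧
    (∀ t ∈ w, t ∈ T) ∧ w.prod = g) (g h : G) :
    wordLength T (g * h) ≤ wordLength T g + wordLength T h := by
  obtain ⟨v, hv, hvT, hvg⟩ := hT g
  obtain ⟨w, hw, hwT, hwh⟩ := hT h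
  rw [← hv, ← hw, ← List.length_append]
  nth_rw 1 [← hvg, ← hwh]
  rw [← List.prod_append]
  refine wordLength_le fun t ht => ?_
  rcases List.mem_append.1 ht with h | h
  exacts [hvT t h, hwT t h]

variable {N : ℕ}

theorem le_card_cycles_add_wordLength (x : Perm (Fin N)) :
    N ≤ Fintype.card (Cycles x) + wordLength (transpositions N) x := by
  obtain ⟨w, hl, hw, rfl⟩ := exists_transposition_word N x
  have := card_le_card_cycles_of_swaps (w := w) hw
  rwa [Fintype.card_fin, hl] at this

theorem wordLength_transpositions_le (x : alternatingGroup (Fin N)) :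
    wordLength (transpositions N) (x : Perm (Fin N)) ≤ 2 * wordLength (threeCycles N) x := by
  obtain ⟨w, hl, hw, hx⟩ := exists_threeCycle_word N x
  rw [← hl, ← hx]
  clear hl hx
  induction w with
  | nil => exact wordLength_le (w := []) (by simp)
  | cons t w ih =>
    have h1 := ih fun s hs => hw s (List.mem_cons_of_mem _ hs)
    obtain ⟨s, r, hs, hr, ht⟩ := exists_swaps_of_isThreeCycle (hw t List.mem_cons_self)
    have h2 : wordLength (transpositions N) (t : Perm (Fin N)) ≤ 2 := by
      have := wordLength_le (T := transpositions N) (w := [s, r]) (by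
        intro t ht
        rcases List.mem_pair.1 ht with rfl | rfl
        exacts [hs, hr])
      simpa [ht] using this
    have h3 := wordLength_mul_le (exists_transposition_word N) (t : Perm (Fin N))
      (w.prod : alternatingGroup (Fin N))
    rw [List.prod_cons, Subgroup.coe_mul, List.length_cons]
    omega

theorem oddCycles_of_wordLength (x : alternatingGroup (Fin N))
    (h : Fintype.card (Cycles (x : Perm (Fin N))) + 2 * wordLength (threeCycles N) x ≤ N) :
    OddCycles (x : Perm (Fin N)) := by
  obtain ⟨w, hl, hw, rfl⟩ := exists_threeCycle_word N x
  rw [← hl] at h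
  have hp : ((w.prod : alternatingGroup (Fin N)) : Perm (Fin N))
      = (w.map ((↑) : alternatingGroup (Fin N) → Perm (Fin N))).prod :=
    map_list_prod (alternatingGroup (Fin N)).subtype w
  rw [hp] at h ⊢
  refine oddCycles_of_card_le ?_ (by simpa using h)
  intro t ht
  obtain ⟨s, hs, rfl⟩ := List.mem_map.1 ht
  exact hw s hs

theorem OddCycles.wordLength_le {x : alternatingGroup (Fin N)}
    (hx : OddCycles (x : Perm (Fin N))) :
    2 * wordLength (threeCycles N) x + Fintype.card (Cycles (x : Perm (Fin N))) ≤ N := by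
  obtain ⟨w, hw, hp, hl⟩ := hx.exists_threeCycle_list
  let v : List (alternatingGroup (Fin N)) :=
    w.attach.map fun t => ⟨t.1, (hw t.1 t.2).mem_alternatingGroup⟩
  have hv : v.prod = x := by
    ext1
    rw [← hp]
    refine (map_list_prod (alternatingGroup (Fin N)).subtype v).trans ?_
    simp [v, Function.comp_def]
  have h1 : wordLength (threeCycles N) v.prod ≤ v.length := by
    refine AltPrefix.wordLength_le fun t ht => ?_
    obtain ⟨s, -, rfl⟩ := List.mem_map.1 ht
    exact hw s.1 s.2
  rw [hv] at h1
  simp only [v, List.length_map, List.length_attach] at h1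
  rw [Fintype.card_fin] at hl
  omega

end WordLength

/-! ### Weak descents -/

section Descents

variable {N : ℕ}

/-- The weak descents of `x`, the points `j` with `x j ≤ j`. -/
def weakDescents (x : Perm (Fin N)) : Finset (Fin N) := {j | x j ≤ j}

theorem mem_weakDescents {x : Perm (Fin N)} {j : Fin N} : j ∈ weakDescents x ↔ x j ≤ j := by
  simp [weakDescents]

/-- The largest point of a cycle is a weak descent. -/
theorem one_le_card_weakDescents_cycle (x : Perm (Fin N)) (q : Cycles x) :
    1 ≤ #{j ∈ weakDescents x | cycleThrough x j = q} := by
  have hne : ({j | cycleThrough x j = q} : Finset (Fin N)).Nonempty := by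
    obtain ⟨j, rfl⟩ := cycleThrough_surjective x q
    exact ⟨j, by simp⟩
  obtain ⟨j, hj, hmax⟩ := exists_max_image _ id hne
  rw [mem_filter_univ] at hj
  refine card_pos.2 ⟨j, mem_filter.2 ⟨mem_weakDescents.2 (hmax (x j) ?_), hj⟩⟩
  simp [hj]

theorem card_weakDescents_eq_sum (x : Perm (Fin N)) :
    #(weakDescents x) = ∑ q : Cycles x, #{j ∈ weakDescents x | cycleThrough x j = q} :=
  card_eq_sum_card_fiberwise fun _ _ => mem_univ _

theorem card_cycles_le_card_weakDescents (x : Perm (Fin N)) :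
    Fintype.card (Cycles x) ≤ #(weakDescents x) := by
  rw [card_weakDescents_eq_sum, ← card_univ, card_eq_sum_ones]
  exact sum_le_sum fun q _ => one_le_card_weakDescents_cycle x q

theorem card_weakDescents_cycle_eq_one {x : Perm (Fin N)}
    (h : #(weakDescents x) ≤ Fintype.card (Cycles x)) (q : Cycles x) :
    #{j ∈ weakDescents x | cycleThrough x j = q} = 1 := by
  rw [card_weakDescents_eq_sum, ← card_univ, card_eq_sum_ones] at h
  exact (((sum_eq_sum_iff_of_le fun q _ => one_le_card_weakDescents_cycle x q).1
    (le_antisymm (sum_le_sum fun q _ => one_le_card_weakDescents_cycle x q) h)) q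
      (mem_univ q)).symm

theorem apply_inv_mul_longCycle (x : Perm (Fin N)) (i : Fin N) :
    x ((x⁻¹ * longCycle N) i) = longCycle N i := by
  simp

/-- Points `i` and `j = y i`, where `y = x⁻¹ c`, satisfy `x j = c i`. If `i` is not the last
point, then `x j = i + 1`, and exactly one of `x j ≤ j` and `j ≤ i` holds; for the last point
both hold, as `x j` is then the first point. -/
theorem weakDescent_add_weakDescent {n : ℕ} {x : Perm (Fin (n + 1))} {i j : Fin (n + 1)}
    (hx : x j = longCycle (n + 1) i) :
    (if x j ≤ j then 1 else 0) + (if j ≤ i then 1 else 0) =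
      1 + if i = Fin.last n then 1 else 0 := by
  rw [longCycle] at hx
  rw [hx]
  by_cases hi : i = Fin.last n
  · subst hi
    simp [Fin.le_last]
  · have hv := coe_finRotate_of_ne_last hi
    simp only [Fin.le_def, hv, if_neg hi]
    split_ifs <;> omega

theorem card_weakDescents_add (n : ℕ) (x : Perm (Fin (n + 1))) :
    #(weakDescents x) + #(weakDescents (x⁻¹ * longCycle (n + 1))) = n + 2 := by
  have h := sum_congr (rfl : (univ : Finset (Fin (n + 1))) = univ)
    fun i _ => weakDescent_add_weakDescent (apply_inv_mul_longCycle x i)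
  rw [sum_add_distrib, sum_add_distrib,
    Equiv.sum_comp (x⁻¹ * longCycle (n + 1)) (fun j => if x j ≤ j then 1 else 0)] at h
  rw [weakDescents, weakDescents, card_filter, card_filter, h]
  simp

/-! ### The parity defect -/

/-- The parity defect of `x` at `j`. It vanishes if `x j - j` is odd at a strict ascent and even
at a weak descent. -/
def defect (x : Perm (Fin N)) (j : Fin N) : ZMod 2 :=
  ((x j : ℕ) : ZMod 2) + ((j : ℕ) : ZMod 2) + (if x j ≤ j then 1 else 0) + 1

theorem sum_defect_cycle (x : Perm (Fin N)) (q : Cycles x) :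
    ∑ j with cycleThrough x j = q, defect x j =
      (#{j ∈ weakDescents x | cycleThrough x j = q} : ZMod 2) +
        (#{j | cycleThrough x j = q} : ZMod 2) := by
  simp only [defect]
  rw [sum_add_distrib, sum_add_distrib, sum_add_distrib,
    sum_cycle_apply (fun j : Fin N => ((j : ℕ) : ZMod 2)) q, CharTwo.add_self_eq_zero, zero_add,
    sum_boole, weakDescents, filter_filter, filter_filter]
  simp [and_comm]

/-- With `y = x⁻¹ c`, the defect of `y` at `i` is that of `x` at `y i`. The last point, where the
count of weak descents differs, is no exception because the number of points is odd. -/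
theorem defect_inv_mul_longCycle (n : ℕ) (x : Perm (Fin (2 * n + 1))) (i : Fin (2 * n + 1)) :
    defect (x⁻¹ * longCycle (2 * n + 1)) i = defect x ((x⁻¹ * longCycle (2 * n + 1)) i) := by
  have hx := apply_inv_mul_longCycle x i
  rw [defect, defect]
  generalize (x⁻¹ * longCycle (2 * n + 1)) i = j at hx ⊢
  have h := congrArg (Nat.cast (R := ZMod 2)) (weakDescent_add_weakDescent hx)
  push_cast at h
  have h2 : (2 : ZMod 2) = 0 := rfl
  have hc : ((x j : ℕ) : ZMod 2) + ((i : ℕ) : ZMod 2) + 1 +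
      (if i = Fin.last (2 * n) then 1 else 0) = 0 := by
    rw [hx, longCycle]
    by_cases hi : i = Fin.last (2 * n)
    · subst hi
      simp only [finRotate_last, if_true, Fin.val_last]
      push_cast
      simp only [Fin.val_zero, Nat.cast_zero]
      linear_combination ((n : ZMod 2) + 1) * h2
    · rw [coe_finRotate_of_ne_last hi, if_neg hi]
      push_cast
      linear_combination (((i : ℕ) : ZMod 2) + 1) * h2
  linear_combination -h - hc + (((i : ℕ) : ZMod 2) + (if j ≤ i then 1 else 0)) * h2

/-! ### Edge functions on a tree -/

theorem sum_mul_comp_eq_zero {K E C : Type*} [Field K] [Fintype E] [Fintype C] [DecidableEq C]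
    {Z : E → C} {d : E → K} (hZ : ∀ c, ∑ e with Z e = c, d e = 0) (h : C → K) :
    ∑ e, d e * h (Z e) = 0 := by
  rw [← sum_fiberwise univ Z]
  refine sum_eq_zero fun c _ => ?_
  rw [sum_congr rfl (g := fun e => d e * h c)
    (fun e he => by rw [(mem_filter.1 he).2]), ← sum_mul, hZ, zero_mul]

/-- Consider the bipartite graph with one edge from `X e` to `Y e` for every `e`, having one more
vertex than edges. If a vertex function whose values at the two ends of every edge agree vanishes
as soon as it vanishes at `X e₀` (that is, if the graph is connected, hence a tree), then an edge
function whose sum around every vertex is zero vanishes. By rank and nullity every edge function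
is a difference of vertex values, and the given one is orthogonal to all of these. -/
theorem eq_zero_of_vertex_sums_eq_zero {K E A B : Type*} [Field K] [Fintype E] [DecidableEq E]
    [Fintype A] [DecidableEq A] [Fintype B] [DecidableEq B] (X : E → A) (Y : E → B) (e₀ : E)
    (hcard : Fintype.card E + 1 ≤ Fintype.card A + Fintype.card B)
    (hconn : ∀ (f : A → K) (g : B → K), (∀ e, f (X e) = g (Y e)) → f (X e₀) = 0 →
      f = 0 ∧ g = 0)
    (d : E → K) (hX : ∀ a, ∑ e with X e = a, d e = 0) (hY : ∀ b, ∑ e with Y e = b, d e = 0) :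
    d = 0 := by
  let φ : (A → K) × (B → K) →ₗ[K] E → K :=
    (LinearMap.funLeft K K X).comp (LinearMap.fst K _ _) -
      (LinearMap.funLeft K K Y).comp (LinearMap.snd K _ _)
  have hφ : ∀ p e, φ p e = p.1 (X e) - p.2 (Y e) := fun p e => rfl
  have hker : Module.finrank K (LinearMap.ker φ) ≤ 1 := by
    rw [← Module.finrank_self K]
    refine LinearMap.finrank_le_finrank_of_injective
      (f := ((LinearMap.proj (φ := fun _ : A => K) (X e₀)).comp (LinearMap.fst K _ _)).comp
        (LinearMap.ker φ).subtype) ?_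
    rw [← LinearMap.ker_eq_bot, LinearMap.ker_eq_bot']
    rintro ⟨⟨f, g⟩, hp⟩ h0
    have := hconn f g (fun e => sub_eq_zero.1 (congrFun (LinearMap.mem_ker.1 hp) e)) h0
    ext1
    exact Prod.ext this.1 this.2
  have hsurj : LinearMap.range φ = ⊤ := by
    apply Submodule.eq_top_of_finrank_eq
    apply le_antisymm (Submodule.finrank_le _)
    have := LinearMap.finrank_range_add_finrank_ker φ
    rw [Module.finrank_prod, Module.finrank_fintype_fun_eq_card,
      Module.finrank_fintype_fun_eq_card] at this
    rw [Module.finrank_fintype_fun_eq_card]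
    omega
  funext e₁
  obtain ⟨⟨f, g⟩, hp⟩ := LinearMap.range_eq_top.1 hsurj (Pi.single e₁ 1)
  have h1 : ∑ e, d e * (f (X e) - g (Y e)) = d e₁ := by
    have : ∀ e, f (X e) - g (Y e) = (Pi.single e₁ 1 : E → K) e := fun e => by
      rw [← hp, hφ]
    simp [this, Pi.single_apply]
  rw [← h1]
  simp only [mul_sub, sum_sub_distrib]
  rw [sum_mul_comp_eq_zero hX, sum_mul_comp_eq_zero hY, sub_zero, Pi.zero_apply]

end Descents

/-! ### The long cycle -/

section LongCycle

theorem eq_zero_of_longCycle_invariant {β : Type*} {n : ℕ} {f : Fin (n + 1) → β}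
    (hf : ∀ i, f (longCycle (n + 1) i) = f i) (i : Fin (n + 1)) : f i = f 0 := by
  induction i using Fin.induction with
  | zero => rfl
  | succ i ih =>
    rw [← ih, ← hf i.castSucc, longCycle, finRotate_apply, Fin.coeSucc_eq_succ]

theorem cycleThrough_longCycle (n : ℕ) (i : Fin (n + 1)) :
    cycleThrough (longCycle (n + 1)) i = cycleThrough (longCycle (n + 1)) 0 :=
  eq_zero_of_longCycle_invariant cycleThrough_apply i

theorem card_cycles_longCycle (n : ℕ) : Fintype.card (Cycles (longCycle (n + 1))) = 1 := by
  refine Fintype.card_eq_one_iff.2 ⟨cycleThrough _ 0, fun q => ?_⟩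
  obtain ⟨i, rfl⟩ := cycleThrough_surjective _ q
  exact cycleThrough_longCycle n i

theorem oddCycles_longCycle (n : ℕ) : OddCycles (longCycle (2 * n + 1)) := by
  intro q
  obtain ⟨i, rfl⟩ := cycleThrough_surjective _ q
  simp [cycleThrough_longCycle]

theorem wordLength_altLongCycle_le (n : ℕ) :
    wordLength (threeCycles (2 * n + 1)) (altLongCycle n) ≤ n := by
  have h := OddCycles.wordLength_le (x := altLongCycle n) (oddCycles_longCycle n)
  have h1 := card_cycles_longCycle (2 * n)
  change _ + Fintype.card (Cycles (longCycle (2 * n + 1))) ≤ _ at h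
  omega

theorem wordLength_longCycle_le (n : ℕ) :
    wordLength (transpositions (2 * n + 1)) (longCycle (2 * n + 1)) ≤ 2 * n :=
  (wordLength_transpositions_le (altLongCycle n)).trans
    (Nat.mul_le_mul_left 2 (wordLength_altLongCycle_le n))

theorem le_wordLength_longCycle (n : ℕ) :
    n ≤ wordLength (transpositions (n + 1)) (longCycle (n + 1)) := by
  have h := le_card_cycles_add_wordLength (longCycle (n + 1))
  rw [card_cycles_longCycle] at h
  omega

theorem card_cycles_add_le (n : ℕ) (x : Perm (Fin (n + 1))) :
    Fintype.card (Cycles x) + Fintype.card (Cycles (x⁻¹ * longCycle (n + 1))) ≤ n + 2 := by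
  rw [← card_weakDescents_add n x]
  exact add_le_add (card_cycles_le_card_weakDescents _) (card_cycles_le_card_weakDescents _)

end LongCycle

/-! ### Vanishing of the defect -/

section Defect

theorem defect_eq_zero {n : ℕ} {x : Perm (Fin (2 * n + 1))}
    (hcard : 2 * n + 2 ≤
      Fintype.card (Cycles x) + Fintype.card (Cycles (x⁻¹ * longCycle (2 * n + 1))))
    (hx : OddCycles x) (hy : OddCycles (x⁻¹ * longCycle (2 * n + 1)))
    (j : Fin (2 * n + 1)) : defect x j = 0 := by
  have hd := card_weakDescents_add (2 * n) x
  have hdx := card_cycles_le_card_weakDescents x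
  have hdy := card_cycles_le_card_weakDescents (x⁻¹ * longCycle (2 * n + 1))
  have hsum : ∀ {z : Perm (Fin (2 * n + 1))}, OddCycles z →
      #(weakDescents z) ≤ Fintype.card (Cycles z) → ∀ q : Cycles z,
      ∑ j with cycleThrough z j = q, defect z j = 0 := by
    intro z hz hdz q
    rw [sum_defect_cycle, card_weakDescents_cycle_eq_one hdz, ZMod.natCast_eq_one_iff_odd.2 (hz q)]
    rfl
  have hsurj := apply_inv_mul_longCycle x
  have hdefect := defect_inv_mul_longCycle n x
  have hsy := hsum hy (by omega)
  generalize x⁻¹ * longCycle (2 * n + 1) = y at *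
  refine congrFun (eq_zero_of_vertex_sums_eq_zero (K := ZMod 2) (cycleThrough x) (cycleThrough y)
    0 (by rw [Fintype.card_fin]; omega) (fun f g hfg h0 => ?_) (defect x) (hsum hx (by omega))
    (fun q => ?_)) j
  · have hconst : ∀ i, f (cycleThrough x i) = 0 := by
      intro i
      rw [← h0]
      refine eq_zero_of_longCycle_invariant (f := fun i => f (cycleThrough x i)) (fun i => ?_) i
      rw [← hsurj, cycleThrough_apply, hfg, cycleThrough_apply, hfg]
    constructor
    · funext q
      obtain ⟨i, rfl⟩ := cycleThrough_surjective _ q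
      exact hconst i
    · funext q
      obtain ⟨i, rfl⟩ := cycleThrough_surjective _ q
      rw [← hfg]
      exact hconst i
  · rw [← sum_cycle_apply, ← hsy q]
    exact sum_congr rfl fun i _ => (hdefect i).symm

theorem oddCycles_of_defect_eq_zero {N : ℕ} {x : Perm (Fin N)}
    (hdesc : #(weakDescents x) ≤ Fintype.card (Cycles x)) (hx : ∀ j, defect x j = 0) :
    OddCycles x := by
  intro q
  have h := sum_defect_cycle x q
  rw [card_weakDescents_cycle_eq_one hdesc, sum_eq_zero fun j _ => hx j] at h
  rw [← ZMod.natCast_eq_one_iff_odd]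
  rw [Nat.cast_one, eq_comm, CharTwo.add_eq_zero] at h
  exact h.symm

end Defect

/-! ### Property (OD) in terms of the defect -/

section OD

variable {N : ℕ} {x : Perm (Fin N)}

theorem natCast_add_eq_one_iff (a b : ℕ) :
    (a : ZMod 2) + b = 1 ↔ Odd ((a : ℤ) - b) := by
  rw [← Nat.cast_add, ZMod.natCast_eq_one_iff_odd, Int.odd_sub, Nat.odd_add]
  simp [← Int.not_even_iff_odd, ← Nat.not_even_iff_odd]

theorem defect_eq_zero_iff_of_lt {j : Fin N} (h : j < x j) :
    defect x j = 0 ↔ Odd (((x j : ℕ) : ℤ) - ((j : ℕ) : ℤ)) := by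
  rw [← natCast_add_eq_one_iff, defect, if_neg (not_le.2 h), add_zero, CharTwo.add_eq_zero]

theorem defect_eq_zero_iff_of_le {j : Fin N} (h : x j ≤ j) :
    defect x j = 0 ↔ ¬ Odd (((x j : ℕ) : ℤ) - ((j : ℕ) : ℤ)) := by
  rw [← natCast_add_eq_one_iff, defect, if_pos h]
  generalize (((x j : ℕ) : ZMod 2) + ((j : ℕ) : ZMod 2)) = a
  revert a
  decide

/-- The chain condition in `PropertyOD` concerns the list of the values of the entries in `ℕ`. -/
theorem propertyOD_iff {u : List (Fin N)} :
    PropertyOD u ↔ Odd u.length ∧ ∀ (k : ℕ) (hk : k + 1 < u.length),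
      Odd (((u[k + 1] : ℕ) : ℤ) - ((u[k] : ℕ) : ℤ)) := by
  unfold PropertyOD
  simp only [List.bind_eq_flatMap, List.pure_def, ← List.map_eq_flatMap]
  simp [List.isChain_iff_getElem]

/-- Along a list with odd steps, the parity of the entry alternates. -/
theorem odd_sub_getElem_zero {u : List (Fin N)}
    (hu : ∀ (k : ℕ) (hk : k + 1 < u.length), Odd (((u[k + 1] : ℕ) : ℤ) - ((u[k] : ℕ) : ℤ)))
    (k : ℕ) (hk : k < u.length) : Odd (((u[k] : ℕ) : ℤ) - ((u[0] : ℕ) : ℤ)) ↔ Odd k := by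
  induction k with
  | zero => simp
  | succ k ih =>
    have h1 := ih (by omega)
    have h2 := hu k hk
    rw [Nat.odd_add_one, ← h1]
    have h3 : ((u[k + 1] : ℕ) : ℤ) - ((u[0] : ℕ) : ℤ) =
      (((u[k + 1] : ℕ) : ℤ) - ((u[k] : ℕ) : ℤ)) + (((u[k] : ℕ) : ℤ) - ((u[0] : ℕ) : ℤ)) := by ring
    rw [h3, Int.odd_add, iff_true_left h2, Int.not_odd_iff_even]

theorem defect_eq_zero_of_propertyOD {i : Fin N} {u : List (Fin N)}
    (hu : IsIncreasingCycleAt x i u) (hOD : PropertyOD u) : defect x i = 0 := by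
  obtain ⟨hi, hlt, hp⟩ := hu
  obtain ⟨hlen, hodd⟩ := propertyOD_iff.1 hOD
  have hn : u.Nodup := hlt.imp fun h => ne_of_lt h
  have hxi : x i = u.formPerm i := by rw [hp, Perm.cycleOf_apply_self]
  obtain ⟨k, hk, rfl⟩ := List.getElem_of_mem hi
  rw [List.formPerm_apply_getElem u hn k hk] at hxi
  by_cases hk' : k + 1 < u.length
  · have hxk : x u[k] = u[k + 1] := by
      rw [hxi]; simp only [Nat.mod_eq_of_lt hk']
    rw [defect_eq_zero_iff_of_lt, hxk]
    · exact hodd k hk'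
    · rw [hxk]
      exact List.pairwise_iff_getElem.1 hlt k (k + 1) hk hk' (Nat.lt_succ_self k)
  · have hke : k + 1 = u.length := by omega
    have hxk : x u[k] = u[0] := by
      rw [hxi]; simp only [hke, Nat.mod_self]
    have h := odd_sub_getElem_zero hodd k hk
    rw [← hke, Nat.odd_add_one] at hlen
    rw [defect_eq_zero_iff_of_le, hxk]
    · rw [← h, ← odd_neg, neg_sub] at hlen
      exact hlen
    · rw [hxk]
      rcases Nat.eq_zero_or_pos k with rfl | h0
      · exact le_rfl
      · exact (List.pairwise_iff_getElem.1 hlt 0 k (by omega) hk h0).le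

/-- A cycle with a single weak descent `M` is increasing when it is written starting from
`x M`. -/
theorem exists_increasingCycle (hdesc : #(weakDescents x) ≤ Fintype.card (Cycles x))
    (hodd : OddCycles x) (hd : ∀ j, defect x j = 0) (i : Fin N) :
    ∃ u : List (Fin N), IsIncreasingCycleAt x i u ∧ PropertyOD u := by
  by_cases hi : x i = i
  · exact ⟨[i], ⟨by simp, by simp, by rw [List.formPerm_singleton, (x.cycleOf_eq_one_iff).2 hi]⟩,
      by simp [PropertyOD]⟩
  obtain ⟨M, hM⟩ := card_eq_one.1 (card_weakDescents_cycle_eq_one hdesc (cycleThrough x i))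
  have hMiff : ∀ a, x a ≤ a ∧ cycleThrough x a = cycleThrough x i ↔ a = M := by
    intro a
    rw [← mem_weakDescents, ← mem_singleton (a := M) (b := a), ← hM, mem_filter]
  have hMi := ((hMiff M).2 rfl).2
  have hsame : x.SameCycle (x M) i := cycleThrough_eq_iff.1 (by rw [cycleThrough_apply, hMi])
  have hm : x (x M) ≠ x M := fun h => hi (hsame.apply_eq_self_iff.1 h)
  have hchain : ∀ (k : ℕ) (hk : k + 1 < (x.toList (x M)).length),
      (x.toList (x M))[k + 1] = x (x.toList (x M))[k] ∧
        (x.toList (x M))[k] < x (x.toList (x M))[k] := by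
    intro k hk
    have hstep : (x.toList (x M))[k + 1] = x (x.toList (x M))[k] := by
      rw [Perm.getElem_toList, Perm.getElem_toList, pow_succ', Perm.mul_apply]
    refine ⟨hstep, lt_of_not_ge fun hle => ?_⟩
    have hcyc : cycleThrough x (x.toList (x M))[k] = cycleThrough x i := by
      rw [← hMi, ← cycleThrough_apply M, eq_comm, cycleThrough_eq_iff]
      exact (Perm.mem_toList_iff.1 (List.getElem_mem _)).1
    have hkM := (hMiff _).1 ⟨hle, hcyc⟩
    have h0 : (x.toList (x M))[k + 1] = (x.toList (x M))[0] := by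
      rw [hstep, hkM, Perm.getElem_toList, pow_zero, Perm.one_apply]
    exact absurd ((Perm.nodup_toList x (x M)).getElem_inj_iff.1 h0) (Nat.succ_ne_zero k)
  refine ⟨x.toList (x M), ⟨?_, ?_, ?_⟩, propertyOD_iff.2 ⟨?_, ?_⟩⟩
  · exact Perm.mem_toList_iff.2 ⟨hsame, Perm.mem_support.2 hm⟩
  · rw [← List.isChain_iff_pairwise, List.isChain_iff_getElem]
    intro k hk
    rw [(hchain k hk).1]
    exact (hchain k hk).2
  · rw [Perm.formPerm_toList, hsame.cycleOf_eq]
  · rw [Perm.length_toList, card_support_cycleOf hm]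
    exact hodd _
  · intro k hk
    rw [(hchain k hk).1]
    exact (defect_eq_zero_iff_of_lt (hchain k hk).2).1 (hd _)

end OD

/-! ### Comparison of the two orders -/

/-- Both sides say that `x` and `y = x⁻¹ c` have `2 * n + 2` cycles in total and that all of these
are odd; on the right the oddness is expressed through the defect. -/
theorem leThree_altLongCycle_iff (n : ℕ) (x : alternatingGroup (Fin (2 * n + 1))) :
    LEThree x (altLongCycle n) ↔ (x : Perm (Fin (2 * n + 1))) ∈ ONC (2 * n + 1) := by
  have hc3 := wordLength_altLongCycle_le n
  have hc2 := le_wordLength_longCycle (2 * n)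
  have hc2' := wordLength_longCycle_le n
  have hy : ((x⁻¹ * altLongCycle n : alternatingGroup _) : Perm (Fin (2 * n + 1))) =
      (x : Perm (Fin (2 * n + 1)))⁻¹ * longCycle (2 * n + 1) := rfl
  have hle := card_cycles_add_le (2 * n) (x : Perm (Fin (2 * n + 1)))
  have hdesc := card_weakDescents_add (2 * n) (x : Perm (Fin (2 * n + 1)))
  have hdx := card_cycles_le_card_weakDescents (x : Perm (Fin (2 * n + 1)))
  have hdy := card_cycles_le_card_weakDescents
    ((x : Perm (Fin (2 * n + 1)))⁻¹ * longCycle (2 * n + 1))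
  have h2x := le_card_cycles_add_wordLength (x : Perm (Fin (2 * n + 1)))
  have h2y := le_card_cycles_add_wordLength
    ((x : Perm (Fin (2 * n + 1)))⁻¹ * longCycle (2 * n + 1))
  have h23x := wordLength_transpositions_le x
  have h23y := wordLength_transpositions_le (x⁻¹ * altLongCycle n)
  rw [hy] at h23y
  constructor
  · intro h
    rw [LEThree, PrefixLE] at h
    -- The chain `2n ≤ ℓ₂(c) ≤ ℓ₂(x) + ℓ₂(y) ≤ 2 ℓ₃(x) + 2 ℓ₃(y) = 2 ℓ₃(c) ≤ 2n` and the bound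
    -- `2n + 2` on the total number of cycles force equality in every estimate.
    have hox := oddCycles_of_wordLength x (by omega)
    have hoy := oddCycles_of_wordLength (x⁻¹ * altLongCycle n) (by rw [hy]; omega)
    have hd := defect_eq_zero (by omega) hox hoy
    refine ⟨?_, exists_increasingCycle (by omega) hox hd⟩
    have hsub := wordLength_mul_le (exists_transposition_word (2 * n + 1))
      (x : Perm (Fin (2 * n + 1))) ((x : Perm (Fin (2 * n + 1)))⁻¹ * longCycle (2 * n + 1))
    rw [mul_inv_cancel_left] at hsub
    change _ = _
    omega
  · rintro ⟨h, hOD⟩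
    change _ = _ at h
    -- From `ℓ₂(x) + ℓ₂(y) = 2n`, there are at least `2n + 2` cycles in total, so every cycle has a
    -- single weak descent.
    have hd : ∀ j, defect (x : Perm (Fin (2 * n + 1))) j = 0 := fun j => by
      obtain ⟨u, hu, hu'⟩ := hOD j
      exact defect_eq_zero_of_propertyOD hu hu'
    have hox := (oddCycles_of_defect_eq_zero (by omega) hd).wordLength_le
    have hoy := OddCycles.wordLength_le (x := x⁻¹ * altLongCycle n)
      (oddCycles_of_defect_eq_zero (by rw [hy]; omega) fun i => by
        rw [hy, defect_inv_mul_longCycle, hd])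
    rw [hy] at hoy
    have hsub := wordLength_mul_le (exists_threeCycle_word (2 * n + 1)) x
      (x⁻¹ * altLongCycle n)
    rw [mul_inv_cancel_left] at hsub
    have h23c : wordLength (transpositions (2 * n + 1)) (longCycle (2 * n + 1)) ≤
        2 * wordLength (threeCycles (2 * n + 1)) (altLongCycle n) :=
      wordLength_transpositions_le (altLongCycle n)
    change _ = _
    omega

end AltPrefix

theorem mainTheorem6 (n : ℕ) (x : alternatingGroup (Fin (2 * n + 1))) :
    AltPrefix.LEThree x (AltPrefix.altLongCycle n) ↔
      (x : Equiv.Perm (Fin (2 * n + 1))) ∈ AltPrefix.ONC (2 * n + 1) :=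
  AltPrefix.leThree_altLongCycle_iff n x
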